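/- Conventions. Let $M$ be an oriented matroid on a finite set $E$. For $A\subseteq E$, $-_AM$ is the reorientation of $M$ obtained by reversing the signs of the elements of $A$; reorientations are labelled by $A$, so that $M$ has $2^{|E|}$ reorientations even if some of them coincide as oriented matroids. An oriented matroid is acyclic if it has no positive circuit, and totally cyclic if every element lies in a positive circuit. Let $f\neq g$ be two elements not in $E$. A generic extension-lifting of $M$ with respect to $(f,g)$ is an oriented matroid $\overline M$ on $E\cup\{f,g\}$ such that $\overline M/g\setminus f=M$, the circuits of $\overline M$ containing $f$ are exactly the sets $B\cup\{f\}$ with $B$ a basis of $\overline M\setminus f$, and the cocircuits of $\overline M$ containing $g$ are exactly the sets $((E\cup\{f\})\setminus B)\cup\{g\}$ with $B$ a basis of $\overline M/g$. A reorientation $-_AM$, $A\subseteq E$, is compatible with $\overline M$ if (1) for every positive cocircuit $D$ of $-_AM$, the corresponding cocircuit $D\cup f$ of $-_A(\overline M/g)$ has a positive sign on $f$; and (2) for every positive circuit $C$ of $-_AM$, the corresponding circuit $C\cup g$ of $-_A(\overline M\setminus f)$ has a positive sign on $g$. A bounded reorientation of $\overline M$ with respect to $(f,g)$ is a reorientation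 $-_{A'}\overline M$, $A'\subseteq E\cup\{f,g\}$, such that $(-_{A'}\overline M)\setminus f$ is acyclic and $(-_{A'}\overline M)/g$ is totally cyclic; it is a bounded region if moreover $f,g\notin A'$. The label $A'$ and its complement $(E\cup\{f,g\})\setminus A'$ give the same oriented matroid (opposite regions). Proposition. Let $M$ be an oriented matroid and $\overline M$ a generic extension-lifting of $M$ with respect to $(f,g)$. The mapping $-_AM\mapsto -_{fg}-_A\overline M$ yields a bijection between the reorientations of $M$ compatible with $\overline M$ and the bounded regions of $\overline M$ with respect to $(f,g)$, each region being identified with its opposite. Explicitly: (a) for $A\subseteq E$ one has $-_{fg}-_A\overline M=-_{A\cup\{f,g\}}\overline M$, and $A\mapsto A\cup\{f,g\}$ is a bijection from the set of $A\subseteq E$ with $-_AM$ compatible onto the set of labels $A'$ of bounded reorientations with $f,g\in A'$; (b) for $A\subseteq E$ one also has $-_{fg}-_A\overline M=-_{E\setminus A}\overline M$, and $A\mapsto E\setminus A$ is a bijection from the set of $A\subseteq E$ with $-_AM$ compatible onto the set of labels $A'$ of bounded regions (those with $f,g\notin A'$). -/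

import Mathlib

open scoped Matroid

/-- The signed set `X` with the element `e` removed (written `X \ e`). Signed subsets are functions
to `SignType = {-1, 0, 1}`; the underlying unsigned set is `Function.support X`. -/
noncomputable def SignedSet.remove {α : Type*} (X : α → SignType) (e : α) : α → SignType :=
  Set.indicator {e}ᶜ X

/-- The signed set obtained from `X` by reversing the signs of the elements of `A`. -/
noncomputable def SignedSet.flip {α : Type*} (A : Set α) (X : α → SignType) : α → SignType :=
  open Classical in fun e => if e ∈ A then - X e else X e

/-- Orthogonality of signed sets: if there is an element on which the two signs agree (and are
nonzero), then there is one on which they are opposite, and conversely. In particular this holds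
if the supports are disjoint. -/
def SignedSet.Orthogonal {α : Type*} (X Y : α → SignType) : Prop :=
  (∃ e, X e * Y e = 1) ↔ (∃ e, X e * Y e = -1)

/-- A signed set without negative elements. -/
def SignedSet.Positive {α : Type*} (X : α → SignType) : Prop :=
  ∀ e, 0 ≤ X e

/-- An oriented matroid on a finite ground set, in the sense of Bland and Las Vergnas: a matroid
together with a signature of its circuits and a signature of its cocircuits (each circuit,
respectively cocircuit, carries exactly two signed sets, which are opposite to each other) such that
signed circuits and signed cocircuits are orthogonal. -/
@[ext]
structure OrientedMatroid (α : Type*) where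
  /-- the underlying (unsigned) matroid -/
  toMatroid : Matroid α
  /-- the signed circuits -/
  IsCircuit : (α → SignType) → Prop
  /-- the signed cocircuits -/
  IsCocircuit : (α → SignType) → Prop
  ground_finite : toMatroid.E.Finite
  support_circuit : ∀ X, IsCircuit X → toMatroid.IsCircuit (Function.support X)
  exists_circuit : ∀ C, toMatroid.IsCircuit C → ∃ X, IsCircuit X ∧ Function.support X = C
  neg_circuit : ∀ X, IsCircuit X → IsCircuit (-X)
  eq_or_neg_circuit : ∀ X Y, IsCircuit X → IsCircuit Y →
    Function.support X = Function.support Y → X = Y ∨ X = -Y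
  support_cocircuit : ∀ X, IsCocircuit X → toMatroid.IsCocircuit (Function.support X)
  exists_cocircuit : ∀ D, toMatroid.IsCocircuit D → ∃ X, IsCocircuit X ∧ Function.support X = D
  neg_cocircuit : ∀ X, IsCocircuit X → IsCocircuit (-X)
  eq_or_neg_cocircuit : ∀ X Y, IsCocircuit X → IsCocircuit Y →
    Function.support X = Function.support Y → X = Y ∨ X = -Y
  orthogonal : ∀ X Y, IsCircuit X → IsCocircuit Y → SignedSet.Orthogonal X Y

namespace SignedSet

variable {α : Type*}

theorem remove_apply_self (X : α → SignType) (e : α) : remove X e e = 0 := by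
  simp [remove]

theorem remove_apply_of_ne (X : α → SignType) {e x : α} (h : x ≠ e) : remove X e x = X x := by
  simp [remove, h]

theorem support_remove (X : α → SignType) (e : α) :
    Function.support (remove X e) = Function.support X \ {e} := by
  rw [remove, Set.support_indicator]
  ext x
  simp [and_comm]

theorem remove_neg (X : α → SignType) (e : α) : remove (-X) e = - remove X e := by
  funext x
  by_cases h : x = e
  · subst h; simp [remove]
  · simp [remove, h]

theorem support_flip (A : Set α) (X : α → SignType) :
    Function.support (flip A X) = Function.support X := by
  ext x
  by_cases h : x ∈ A <;> simp [flip, h]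

theorem flip_flip (A : Set α) (X : α → SignType) : flip A (flip A X) = X := by
  funext x
  by_cases h : x ∈ A <;> simp [flip, h]

theorem flip_neg (A : Set α) (X : α → SignType) : flip A (-X) = - flip A X := by
  funext x
  by_cases h : x ∈ A <;> simp [flip, h]

theorem flip_mul_flip (A : Set α) (X Y : α → SignType) (x : α) :
    flip A X x * flip A Y x = X x * Y x := by
  by_cases h : x ∈ A <;> simp [flip, h]

theorem Orthogonal.symm {X Y : α → SignType} (h : Orthogonal X Y) : Orthogonal Y X := by
  unfold Orthogonal at h ⊢
  simpa only [mul_comm] using h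

end SignedSet

namespace OrientedMatroid

variable {α : Type*}

/-- The dual oriented matroid. -/
def dual (M : OrientedMatroid α) : OrientedMatroid α where
  toMatroid := M.toMatroid✶
  IsCircuit := M.IsCocircuit
  IsCocircuit := M.IsCircuit
  ground_finite := M.ground_finite
  support_circuit := M.support_cocircuit
  exists_circuit := M.exists_cocircuit
  neg_circuit := M.neg_cocircuit
  eq_or_neg_circuit := M.eq_or_neg_cocircuit
  support_cocircuit := fun X hX => by simpa using M.support_circuit X hX
  exists_cocircuit := fun D hD => M.exists_circuit D (by simpa using hD)
  neg_cocircuit := M.neg_circuit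
  eq_or_neg_cocircuit := M.eq_or_neg_circuit
  orthogonal := fun X Y hX hY => (M.orthogonal Y X hY hX).symm

/-- The reorientation `-_A M`. -/
noncomputable def reorient (M : OrientedMatroid α) (A : Set α) : OrientedMatroid α where
  toMatroid := M.toMatroid
  IsCircuit := fun X => M.IsCircuit (SignedSet.flip A X)
  IsCocircuit := fun X => M.IsCocircuit (SignedSet.flip A X)
  ground_finite := M.ground_finite
  support_circuit := fun X hX => by
    simpa [SignedSet.support_flip] using M.support_circuit _ hX
  exists_circuit := fun C hC => by
    obtain ⟨X, hX, rfl⟩ := M.exists_circuit C hC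
    exact ⟨SignedSet.flip A X, by rwa [SignedSet.flip_flip], SignedSet.support_flip A X⟩
  neg_circuit := fun X hX => by
    rw [SignedSet.flip_neg]; exact M.neg_circuit _ hX
  eq_or_neg_circuit := fun X Y hX hY h => by
    rcases M.eq_or_neg_circuit _ _ hX hY (by simpa [SignedSet.support_flip] using h) with h | h
    · left; rw [← SignedSet.flip_flip A X, h, SignedSet.flip_flip]
    · right
      rw [← SignedSet.flip_flip A X, h, SignedSet.flip_neg, SignedSet.flip_flip]
  support_cocircuit := fun X hX => by
    simpa [SignedSet.support_flip] using M.support_cocircuit _ hX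
  exists_cocircuit := fun C hC => by
    obtain ⟨X, hX, rfl⟩ := M.exists_cocircuit C hC
    exact ⟨SignedSet.flip A X, by rwa [SignedSet.flip_flip], SignedSet.support_flip A X⟩
  neg_cocircuit := fun X hX => by
    rw [SignedSet.flip_neg]; exact M.neg_cocircuit _ hX
  eq_or_neg_cocircuit := fun X Y hX hY h => by
    rcases M.eq_or_neg_cocircuit _ _ hX hY (by simpa [SignedSet.support_flip] using h) with h | h
    · left; rw [← SignedSet.flip_flip A X, h, SignedSet.flip_flip]
    · right
      rw [← SignedSet.flip_flip A X, h, SignedSet.flip_neg, SignedSet.flip_flip]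
  orthogonal := fun X Y hX hY => by
    have h := M.orthogonal _ _ hX hY
    simpa only [SignedSet.Orthogonal, SignedSet.flip_mul_flip] using h

/-- The deletion `M \ f`: its signed circuits are the signed circuits of `M` avoiding `f`, its
signed cocircuits are the sets `Y \ f`, for `Y` a signed cocircuit of `M`, whose support is
a cocircuit of the deletion (that is, those of minimal nonempty support). -/
noncomputable def delete (M : OrientedMatroid α) (f : α) : OrientedMatroid α where
  toMatroid := M.toMatroid ＼ {f}
  IsCircuit := fun X => M.IsCircuit X ∧ X f = 0
  IsCocircuit := fun X => (M.toMatroid ＼ {f}).IsCocircuit (Function.support X) ∧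
    ∃ Y, M.IsCocircuit Y ∧ SignedSet.remove Y f = X
  ground_finite := M.ground_finite.subset Set.sdiff_subset
  support_circuit := fun X hX => by
    rw [Matroid.delete_isCircuit_iff]
    exact ⟨M.support_circuit X hX.1, by simp [hX.2]⟩
  exists_circuit := fun C hC => by
    rw [Matroid.delete_isCircuit_iff] at hC
    obtain ⟨X, hX, rfl⟩ := M.exists_circuit C hC.1
    exact ⟨X, ⟨hX, by simpa using hC.2⟩, rfl⟩
  neg_circuit := fun X hX => ⟨M.neg_circuit X hX.1, by simp [hX.2]⟩
  eq_or_neg_circuit := fun X Y hX hY h => M.eq_or_neg_circuit X Y hX.1 hY.1 h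
  support_cocircuit := fun X hX => hX.1
  exists_cocircuit := fun D hD => by
    have hD' := hD
    rw [Matroid.isCocircuit_def, Matroid.dual_delete] at hD'
    obtain ⟨D', hD'1, hsub, hsub'⟩ := hD'.exists_subset_isCircuit_of_contract
    obtain ⟨Y, hY, rfl⟩ := M.exists_cocircuit D' hD'1
    have hf : f ∉ D := fun h => (hD.subset_ground h).2 rfl
    have hs : Function.support (SignedSet.remove Y f) = D := by
      rw [SignedSet.support_remove]
      ext x
      constructor
      · rintro ⟨hx, hxf⟩
        exact (hsub' hx).resolve_right hxf
      · intro hx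
        exact ⟨hsub hx, fun h => hf (h ▸ hx)⟩
    exact ⟨SignedSet.remove Y f, ⟨by rwa [hs], Y, hY, rfl⟩, hs⟩
  neg_cocircuit := by
    rintro X ⟨hX, Y, hY, rfl⟩
    exact ⟨by rwa [show Function.support (-SignedSet.remove Y f) =
      Function.support (SignedSet.remove Y f) by ext; simp], -Y, M.neg_cocircuit Y hY, SignedSet.remove_neg Y f⟩
  eq_or_neg_cocircuit := by
    rintro _ _ ⟨_, Y, hY, rfl⟩ ⟨_, Z, hZ, rfl⟩ h
    rw [SignedSet.support_remove, SignedSet.support_remove] at h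
    have hYZ : Function.support Y = Function.support Z := by
      have key : Function.support Y ⊆ Function.support Z ∨
          Function.support Z ⊆ Function.support Y := by
        by_cases hf : f ∈ Function.support Z
        · left
          intro x hx
          by_cases hxf : x = f
          · rwa [hxf]
          · exact (h.subset ⟨hx, hxf⟩).1
        · right
          intro x hx
          exact (h.superset ⟨hx, fun hxf => hf (hxf ▸ hx)⟩).1
      rcases key with key | key
      · exact (M.support_cocircuit Y hY).eq_of_subset_isCircuit (M.support_cocircuit Z hZ) key
      · exact ((M.support_cocircuit Z hZ).eq_of_subset_isCircuit
          (M.support_cocircuit Y hY) key).symm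
    rcases M.eq_or_neg_cocircuit Y Z hY hZ hYZ with rfl | rfl
    · left; rfl
    · right; exact SignedSet.remove_neg Z f
  orthogonal := by
    rintro X _ ⟨hX, hXf⟩ ⟨_, Y, hY, rfl⟩
    have hmul : ∀ e, X e * SignedSet.remove Y f e = X e * Y e := by
      intro e
      by_cases h : e = f
      · subst h; simp [hXf]
      · rw [SignedSet.remove_apply_of_ne Y h]
    simpa only [SignedSet.Orthogonal, hmul] using M.orthogonal X Y hX hY

/-- The contraction `M / g`, the operation dual to deletion: its signed cocircuits are the signed
cocircuits of `M` avoiding `g`, its signed circuits are the sets `Y \ g`, for `Y` a signed circuit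
of `M`, whose support is a circuit of the matroid contraction. -/
noncomputable def contract (M : OrientedMatroid α) (g : α) : OrientedMatroid α :=
  (M.dual.delete g).dual

/-- No signed circuit is positive. -/
def Acyclic (M : OrientedMatroid α) : Prop :=
  ∀ X, M.IsCircuit X → ¬ SignedSet.Positive X

/-- Every element belongs to a positive signed circuit. -/
def TotallyCyclic (M : OrientedMatroid α) : Prop :=
  ∀ e ∈ M.toMatroid.E, ∃ X, M.IsCircuit X ∧ SignedSet.Positive X ∧ X e ≠ 0

/-- `N` is an extension of `M` with respect to `f`. -/
def IsExtension (N M : OrientedMatroid α) (f : α) : Prop :=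
  f ∉ M.toMatroid.E ∧ f ∈ N.toMatroid.E ∧ N.delete f = M

/-- `N` is a lifting of `M` with respect to `g`. -/
def IsLifting (N M : OrientedMatroid α) (g : α) : Prop :=
  g ∉ M.toMatroid.E ∧ g ∈ N.toMatroid.E ∧ N.contract g = M

/-- Generic extension: the circuits of `N` containing `f` are exactly the sets `B ∪ f`, where `B`
is a basis of `M`. -/
def IsGenericExtension (N M : OrientedMatroid α) (f : α) : Prop :=
  N.IsExtension M f ∧ ∀ C : Set α,
    (N.toMatroid.IsCircuit C ∧ f ∈ C) ↔ ∃ B, M.toMatroid.IsBase B ∧ C = insert f B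

/-- Generic lifting: the cocircuits of `N` containing `g` are exactly the sets `(E \ B) ∪ g`, where
`B` is a basis of `M` and `E` is the ground set of `M`. -/
def IsGenericLifting (N M : OrientedMatroid α) (g : α) : Prop :=
  N.IsLifting M g ∧ ∀ D : Set α,
    (N.toMatroid.IsCocircuit D ∧ g ∈ D) ↔
      ∃ B, M.toMatroid.IsBase B ∧ D = insert g (M.toMatroid.E \ B)

/-- `N` is a generic extension-lifting of `M` with respect to `(f, g)`. -/
def IsGenericExtensionLifting (N M : OrientedMatroid α) (f g : α) : Prop :=
  f ∉ M.toMatroid.E ∧ g ∉ M.toMatroid.E ∧ f ≠ g ∧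
  N.toMatroid.E = M.toMatroid.E ∪ {f, g} ∧
  (N.contract g).delete f = M ∧
  N.IsGenericExtension (N.delete f) f ∧
  N.IsGenericLifting (N.contract g) g

/-- For an extension `N` of `M` with respect to `f`: the reorientation `-_A M` is compatible with
the extension, i.e. for every positive cocircuit `X` of `-_A M`, the corresponding cocircuit
`X ∪ f` of `-_A N` has a positive sign on `f`. -/
def CompatibleWithExtension (M N : OrientedMatroid α) (f : α) (A : Set α) : Prop :=
  ∀ X, (M.reorient A).IsCocircuit X → SignedSet.Positive X →
    ∃ Y, (N.reorient A).IsCocircuit Y ∧ SignedSet.remove Y f = X ∧ Y f = 1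

/-- For a lifting `N` of `M` with respect to `g`: the reorientation `-_A M` is compatible with
the lifting, i.e. for every positive circuit `X` of `-_A M`, the corresponding circuit `X ∪ g` of
`-_A N` has a positive sign on `g`. -/
def CompatibleWithLifting (M N : OrientedMatroid α) (g : α) (A : Set α) : Prop :=
  ∀ X, (M.reorient A).IsCircuit X → SignedSet.Positive X →
    ∃ Y, (N.reorient A).IsCircuit Y ∧ SignedSet.remove Y g = X ∧ Y g = 1

/-- `-_A M`, for `A ⊆ E`, is compatible with the extension-lifting `N` of `M` with respect to
`(f, g)`: it is compatible with the extension `N / g` of `M` with respect to `f`, and with the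
lifting `N \ f` of `M` with respect to `g`. -/
def Compatible (M N : OrientedMatroid α) (f g : α) (A : Set α) : Prop :=
  A ⊆ M.toMatroid.E ∧
  M.CompatibleWithExtension (N.contract g) f A ∧
  M.CompatibleWithLifting (N.delete f) g A

/-- The reorientation `-_A N`, `A` a subset of the ground set, is bounded with respect to `(f, g)`:
`(-_A N) \ f` is acyclic and `(-_A N) / g` is totally cyclic. This does not change when `A`
is replaced with its complement (the opposite region). -/
def IsBoundedReorientation (N : OrientedMatroid α) (f g : α) (A : Set α) : Prop :=
  A ⊆ N.toMatroid.E ∧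
  ((N.reorient A).delete f).Acyclic ∧
  ((N.reorient A).contract g).TotallyCyclic

/-- `-_A N` is a bounded region of `N` with respect to `(f, g)`: a bounded reorientation such that
neither `f` nor `g` is reoriented. -/
def IsBoundedRegion (N : OrientedMatroid α) (f g : α) (A : Set α) : Prop :=
  f ∉ A ∧ g ∉ A ∧ N.IsBoundedReorientation f g A

end OrientedMatroid

/-! Everything rests on one criterion, `forall_lift_iff_acyclic`: if `g` is not a loop of `P`, then
all positive circuits of `P / g` lift to circuits of `P` with sign + on `g` exactly when reversing
`g` leaves no positive circuit. A lift with sign 0 or - on `g` becomes a positive circuit after the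
reversal. Conversely, a positive circuit of the reversed matroid through `g` contradicts the
uniqueness of signatures up to sign. One avoiding `g` is either still a circuit of `P / g`, whose
required lift would be a circuit properly containing it, or gives rise to a positive circuit through
`g`; the alternative is Minty's `painting` lemma.

Since `N / g \ f = N \ f / g`, applying this to the reorientation of `N \ f` by `A` turns condition
(2) into acyclicity of the deletion of `f` from the reorientation by `A ∪ {f, g}`. Total cyclicity
being dual to acyclicity, the same statement for the dual, with `f` and `g` exchanged, turns (1)
into total cyclicity of the contraction by `g`. Genericity is needed to know that `g` is not a loop
and `f` is not a coloop. The second bijection follows because complementary labels define the same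
reorientation. -/

open Function

/-! ### Circuits and cocircuits of unoriented matroids -/

namespace Matroid

variable {α : Type*} {M : Matroid α} {e g : α} {C D G : Set α}

/-- For a basis `I` of `G`, some cocircuit meets the independent set `I ∪ {e}` only in `e`. If it
contained some `x` in `G`, it would meet a circuit contained in `I ∪ {x}` only in `x`. -/
theorem exists_isCocircuit_of_notMem_closure (he : e ∈ M.E) (heG : e ∉ M.closure G) :
    ∃ K, M.IsCocircuit K ∧ e ∈ K ∧ Disjoint K G := by
  obtain ⟨I, hI⟩ := M.exists_isBasis' G
  have heI : e ∉ M.closure I := by rwa [hI.closure_eq_closure]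
  have hi : M.Indep (insert e I) := (hI.indep.notMem_closure_iff he).1 heI |>.1
  obtain ⟨K, hK, hKI⟩ := hi.exists_isCocircuit_inter_eq_mem (Set.mem_insert e I)
  have heK : e ∈ K := (hKI.superset rfl).1
  have hKI' : ∀ x ∈ K, x ∈ I → x = e := fun x hx hxI => hKI.subset ⟨hx, Or.inr hxI⟩
  have heI' : e ∉ I := fun h => heI (M.mem_closure_of_mem' h he)
  refine ⟨K, hK, heK, Set.disjoint_left.2 fun x hxK hxG => ?_⟩
  have hxI : x ∉ I := fun h => heI' (hKI' x hxK h ▸ h)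
  have hxc : x ∈ M.closure I := by
    rw [hI.closure_eq_closure]
    exact M.mem_closure_of_mem' hxG (hK.subset_ground hxK)
  obtain ⟨C, hCI, hC, hxC⟩ := exists_isCircuit_of_mem_closure hxc hxI
  refine hC.inter_isCocircuit_ne_singleton (e := x) hK (Set.Subset.antisymm ?_ ?_)
  · rintro y ⟨hyC, hyK⟩
    rcases hCI hyC with h | h
    · exact h
    · exact absurd (hKI' y hyK h ▸ h) heI'
  · rintro _ rfl
    exact ⟨hxC, hxK⟩

/-- A circuit disjoint from some cocircuit through `g` remains a circuit after contracting `g`. -/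
theorem IsCircuit.isCircuit_contractElem_of_disjoint_isCocircuit (hC : M.IsCircuit C)
    (hD : M.IsCocircuit D) (hg : g ∈ D) (hCD : Disjoint C D) : (M ／ {g}).IsCircuit C := by
  have hgC : g ∉ C := fun h => Set.disjoint_left.1 hCD h hg
  obtain ⟨C', hC'C, hC'⟩ :=
    (hC.contract_dep (C := {g}) (Set.disjoint_singleton_left.2 hgC)).exists_isCircuit_subset
  obtain ⟨C'', hC'', -, hsub'⟩ := hC'.exists_subset_isCircuit_of_contract
  -- Otherwise the circuit `C''` and the cocircuit `D` would meet in `g` alone.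
  have hgC'' : g ∉ C'' := fun h =>
    hC''.inter_isCocircuit_ne_singleton (e := g) hD <| Set.Subset.antisymm
      (fun x hx => (hsub' hx.1).resolve_left
        fun hxC => Set.disjoint_left.1 hCD (hC'C hxC) hx.2)
      (by rintro _ rfl; exact ⟨h, hg⟩)
  have hC''C : C'' ⊆ C := fun x hx =>
    (hsub' hx).elim (fun h => hC'C h) fun h => absurd (h ▸ hx) hgC''
  have heq := hC''.eq_of_subset_isCircuit hC hC''C
  have hCC' : C ⊆ C' := fun x hx =>
    (hsub' (heq.superset hx)).resolve_right fun h => hgC (h ▸ hx)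
  rwa [← Set.Subset.antisymm hC'C hCC']

end Matroid

/-! ### Signed sets -/

namespace SignedSet

variable {α : Type*}

theorem flip_flip_eq_symmDiff (A B : Set α) (X : α → SignType) :
    flip A (flip B X) = flip (symmDiff A B) X := by
  funext x
  by_cases hA : x ∈ A <;> by_cases hB : x ∈ B <;> simp [flip, hA, hB, Set.mem_symmDiff]

theorem remove_flip (A : Set α) (X : α → SignType) (g : α) :
    remove (flip A X) g = flip A (remove X g) := by
  funext x
  by_cases h : x = g
  · subst h
    simp [remove, flip]
  · simp [remove, flip, h]

theorem remove_eq_flip_iff (A : Set α) (X Y : α → SignType) (g : α) :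
    remove Y g = flip A X ↔ remove (flip A Y) g = X := by
  rw [remove_flip]
  constructor <;> rintro h
  · rw [h, flip_flip]
  · rw [← h, flip_flip]

theorem Orthogonal.mul_eq_zero {X Y : α → SignType} (h : Orthogonal X Y)
    (h0 : ∀ x, 0 ≤ X x * Y x) (x : α) : X x * Y x = 0 := by
  have hs : ∀ s : SignType, 0 ≤ s → s ≠ 1 → s = 0 := by decide
  refine hs _ (h0 x) fun h1 => ?_
  obtain ⟨y, hy⟩ := h.1 ⟨x, h1⟩
  have := h0 y
  rw [hy] at this
  exact absurd this (by decide)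

end SignedSet

namespace OrientedMatroid

open SignedSet

variable {α : Type*}

/-- Cocircuits appear as circuits of the dual, so that one lemma about circuits, applied to a
matroid and to its dual, settles both conditions. -/
theorem ext_of_dual {M N : OrientedMatroid α} (h : M.toMatroid = N.toMatroid)
    (h₁ : ∀ X, M.IsCircuit X ↔ N.IsCircuit X) (h₂ : ∀ X, M.dual.IsCircuit X ↔ N.dual.IsCircuit X) :
    M = N :=
  OrientedMatroid.ext h (funext fun X => propext (h₁ X)) (funext fun X => propext (h₂ X))

/-! ### Minty's painting lemma -/

section Painting

variable (M : OrientedMatroid α)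

theorem exists_circuit_apply_eq_one {C : Set α} {e : α} (hC : M.toMatroid.IsCircuit C)
    (he : e ∈ C) : ∃ X, M.IsCircuit X ∧ support X = C ∧ X e = 1 := by
  obtain ⟨X, hX, rfl⟩ := M.exists_circuit C hC
  have h : X e = 1 ∨ X e = -1 := by
    have := mem_support.1 he
    revert this
    generalize X e = s
    decide +revert
  rcases h with h | h
  · exact ⟨X, hX, rfl, h⟩
  · exact ⟨-X, M.neg_circuit X hX, by ext; simp, by simp [h]⟩

/-- Minty's painting lemma, with elements of `B` painted black, those of `G` green, and the
remaining ones red. -/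
theorem painting (B : Finset α) {e : α} (he : e ∈ M.toMatroid.E) (heB : e ∉ B) (G : Set α)
    (heG : e ∉ G) (hBG : ∀ b ∈ B, b ∉ G) :
    (∃ X, M.IsCircuit X ∧ X e = 1 ∧ (∀ b ∈ B, 0 ≤ X b) ∧
      ∀ x, X x ≠ 0 → x = e ∨ x ∈ B ∨ x ∈ G) ∨
    (∃ Y, M.IsCocircuit Y ∧ Y e = 1 ∧ (∀ b ∈ B, 0 ≤ Y b) ∧ ∀ x ∈ G, Y x = 0) := by
  classical
  induction B using Finset.induction_on generalizing G with
  | empty =>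
    by_cases h : e ∈ M.toMatroid.closure G
    · obtain ⟨C, hCG, hC, heC⟩ := Matroid.exists_isCircuit_of_mem_closure h heG
      obtain ⟨X, hX, rfl, hXe⟩ := M.exists_circuit_apply_eq_one hC heC
      refine Or.inl ⟨X, hX, hXe, by simp, fun x hx => ?_⟩
      rcases hCG hx with h | h <;> simp [h]
    · obtain ⟨K, hK, heK, hKG⟩ := Matroid.exists_isCocircuit_of_notMem_closure he h
      obtain ⟨Y, hY, rfl, hYe⟩ := M.dual.exists_circuit_apply_eq_one hK heK
      exact Or.inr ⟨Y, hY, hYe, by simp,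
        fun x hx => notMem_support.1 (Set.disjoint_right.1 hKG hx)⟩
  | insert b B hb ih =>
    rw [Finset.mem_insert, not_or] at heB
    rw [Finset.forall_mem_insert] at hBG
    -- Paint `b` red first. Only a cocircuit negative on `b` fails to settle the claim.
    rcases ih heB.2 G heG hBG.2 with ⟨X, hX, hXe, hXB, hXs⟩ | ⟨Y, hY, hYe, hYB, hYG⟩
    · refine Or.inl ⟨X, hX, hXe, (Finset.forall_mem_insert _ _ _).2 ⟨?_, hXB⟩, fun x hx => ?_⟩
      · by_contra h
        rcases hXs b fun h' => h h'.ge with h' | h' | h'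
        · exact heB.1 h'.symm
        · exact hb h'
        · exact hBG.1 h'
      · rcases hXs x hx with h | h | h <;> simp [h]
    by_cases hYb : 0 ≤ Y b
    · exact Or.inr ⟨Y, hY, hYe, (Finset.forall_mem_insert _ _ _).2 ⟨hYb, hYB⟩, hYG⟩
    have hgreen : ∀ x ∈ B, x ∉ insert b G := by
      rintro x hx (rfl | h)
      · exact hb hx
      · exact hBG.2 x hx h
    -- Now paint `b` green. Only a circuit negative on `b` fails to settle the claim.
    rcases ih heB.2 (insert b G) (fun h => h.elim heB.1 heG) hgreen with
      ⟨X, hX, hXe, hXB, hXs⟩ | ⟨Z, hZ, hZe, hZB, hZG⟩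
    swap
    · refine Or.inr ⟨Z, hZ, hZe, (Finset.forall_mem_insert _ _ _).2 ⟨?_, hZB⟩,
        fun x hx => hZG x (Or.inr hx)⟩
      rw [hZG b (Set.mem_insert b G)]
    have hXs' : ∀ x, X x ≠ 0 → x = e ∨ x ∈ insert b B ∨ x ∈ G := fun x hx => by
      rcases hXs x hx with h | h | h | h <;> simp [h]
    by_cases hXb : 0 ≤ X b
    · exact Or.inl ⟨X, hX, hXe, (Finset.forall_mem_insert _ _ _).2 ⟨hXb, hXB⟩, hXs'⟩
    exfalso
    have hneg : ∀ s : SignType, ¬ 0 ≤ s → s = -1 := by decide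
    -- Both attempts failed: `X` and `Y` agree on `e` and on `b`, and their product is nowhere
    -- negative, against orthogonality.
    obtain ⟨x, hx⟩ := (M.orthogonal X Y hX hY).1 ⟨e, by simp [hXe, hYe]⟩
    have hx0 : X x ≠ 0 := fun h => by simp [h] at hx
    rcases hXs' x hx0 with rfl | h | h
    · simp [hXe, hYe] at hx
    · rcases Finset.mem_insert.1 h with rfl | h
      · simp [hneg _ hXb, hneg _ hYb] at hx
      · have := hXB x h
        have := hYB x h
        revert hx
        generalize X x = s at *
        generalize Y x = t at *
        decide +revert
    · simp [hYG x h] at hx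

/-- Every element of an oriented matroid lies in a positive circuit or in a positive cocircuit. -/
theorem exists_positive_circuit_or_cocircuit {e : α} (he : e ∈ M.toMatroid.E) :
    (∃ X, M.IsCircuit X ∧ Positive X ∧ X e = 1) ∨
      (∃ Y, M.IsCocircuit Y ∧ Positive Y ∧ Y e = 1) := by
  classical
  have key : ∀ X : α → SignType, X e = 1 → support X ⊆ M.toMatroid.E →
      (∀ b ∈ M.ground_finite.toFinset.erase e, 0 ≤ X b) → Positive X := by
    intro X hXe hX h x
    by_cases hx : x ∈ M.toMatroid.E
    · by_cases hxe : x = e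
      · rw [hxe, hXe]; decide
      · exact h x (by simp [hx, hxe])
    · rw [notMem_support.1 fun h => hx (hX h)]
  -- Every element other than `e` is black.
  rcases M.painting (M.ground_finite.toFinset.erase e) he (by simp) ∅ (by simp) (by simp) with
    ⟨X, hX, hXe, hXB, -⟩ | ⟨X, hX, hXe, hXB, -⟩
  · exact Or.inl ⟨X, hX, key X hXe (M.support_circuit X hX).subset_ground hXB, hXe⟩
  · exact Or.inr ⟨X, hX, key X hXe (M.support_cocircuit X hX).subset_ground hXB, hXe⟩

end Painting

/-- An oriented matroid is totally cyclic if and only if its dual is acyclic. -/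
theorem totallyCyclic_iff_acyclic_dual (M : OrientedMatroid α) :
    M.TotallyCyclic ↔ M.dual.Acyclic := by
  constructor
  · intro h Y hY hpos
    obtain ⟨e, he⟩ := (M.support_cocircuit Y hY).nonempty
    obtain ⟨X, hX, hXpos, hXe⟩ := h e ((M.support_cocircuit Y hY).subset_ground he)
    have hmul : ∀ s t : SignType, 0 ≤ s → 0 ≤ t → 0 ≤ s * t := by decide
    exact mul_ne_zero hXe he
      (Orthogonal.mul_eq_zero (M.orthogonal X Y hX hY) (fun x => hmul _ _ (hXpos x) (hpos x)) e)
  · intro h e he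
    rcases M.exists_positive_circuit_or_cocircuit he with ⟨X, hX, hpos, hXe⟩ | ⟨Y, hY, hpos, -⟩
    · exact ⟨X, hX, hpos, by simp [hXe]⟩
    · exact absurd hpos (h Y hY)

/-! ### Duality and minors -/

theorem dual_dual (M : OrientedMatroid α) : M.dual.dual = M :=
  OrientedMatroid.ext (Matroid.dual_dual _) rfl rfl

theorem dual_contract (M : OrientedMatroid α) (g : α) : (M.contract g).dual = M.dual.delete g :=
  dual_dual _

theorem dual_delete (M : OrientedMatroid α) (f : α) : (M.delete f).dual = M.dual.contract f := by
  rw [contract, dual_dual]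

theorem toMatroid_contract (M : OrientedMatroid α) (g : α) :
    (M.contract g).toMatroid = M.toMatroid ／ {g} := by
  simp [contract, dual, delete]

theorem isCircuit_contract_iff (M : OrientedMatroid α) (g : α) (X : α → SignType) :
    (M.contract g).IsCircuit X ↔
      (M.toMatroid ／ {g}).IsCircuit (support X) ∧ ∃ Y, M.IsCircuit Y ∧ remove Y g = X := by
  change (M.toMatroid✶ ＼ {g}).IsCocircuit (support X) ∧ _ ↔ _
  rw [Matroid.isCocircuit_def, Matroid.dual_delete, Matroid.dual_dual]
  rfl

theorem contract_delete_circuit_iff (N : OrientedMatroid α) {f g : α} (hfg : f ≠ g)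
    (X : α → SignType) :
    ((N.contract g).delete f).IsCircuit X ↔ ((N.delete f).contract g).IsCircuit X := by
  change (N.contract g).IsCircuit X ∧ X f = 0 ↔ _
  rw [isCircuit_contract_iff, isCircuit_contract_iff]
  change _ ↔ (N.toMatroid ＼ {f} ／ {g}).IsCircuit _ ∧ ∃ Y, (N.IsCircuit Y ∧ Y f = 0) ∧ _
  rw [← Matroid.contract_delete_comm _ (Set.disjoint_singleton.2 hfg.symm),
    Matroid.delete_isCircuit_iff, Set.disjoint_singleton_right, notMem_support]
  constructor
  · rintro ⟨⟨hX, Y, hY, rfl⟩, hXf⟩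
    exact ⟨⟨hX, hXf⟩, Y, ⟨hY, by rwa [remove_apply_of_ne Y hfg] at hXf⟩, rfl⟩
  · rintro ⟨⟨hX, hXf⟩, Y, ⟨hY, -⟩, rfl⟩
    exact ⟨⟨hX, Y, hY, rfl⟩, hXf⟩

theorem contract_delete_comm (N : OrientedMatroid α) {f g : α} (hfg : f ≠ g) :
    (N.contract g).delete f = (N.delete f).contract g := by
  refine ext_of_dual ?_ (N.contract_delete_circuit_iff hfg) fun X => ?_
  · rw [toMatroid_contract]
    change (N.contract g).toMatroid ＼ {f} = N.toMatroid ＼ {f} ／ {g}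
    rw [toMatroid_contract, Matroid.contract_delete_comm _ (Set.disjoint_singleton.2 hfg.symm)]
  · rw [dual_delete, dual_contract, dual_contract, dual_delete]
    exact (N.dual.contract_delete_circuit_iff hfg.symm X).symm

/-! ### Reorientation and the lifting criterion -/

theorem isCircuit_contract_reorient_iff (P : OrientedMatroid α) (g : α) (A : Set α)
    (X : α → SignType) :
    ((P.reorient A).contract g).IsCircuit X ↔ ((P.contract g).reorient A).IsCircuit X := by
  change _ ↔ (P.contract g).IsCircuit (SignedSet.flip A X)
  rw [isCircuit_contract_iff, isCircuit_contract_iff, support_flip]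
  refine and_congr_right fun _ => ⟨?_, ?_⟩
  · rintro ⟨Y, hY, rfl⟩
    exact ⟨SignedSet.flip A Y, hY, remove_flip A Y g⟩
  · rintro ⟨Y, hY, h⟩
    refine ⟨SignedSet.flip A Y, ?_, (remove_eq_flip_iff A X Y g).1 h⟩
    change P.IsCircuit (SignedSet.flip A (SignedSet.flip A Y))
    rwa [SignedSet.flip_flip]

/-- All positive circuits of `P / g` lift to circuits of `P` with a positive sign on `g` if and only
if the reorientation of `P` at `g` is acyclic. -/
theorem forall_lift_iff_acyclic (P : OrientedMatroid α) {g : α} (hg : P.toMatroid.IsNonloop g) :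
    (∀ X, (P.contract g).IsCircuit X → Positive X →
      ∃ Y, P.IsCircuit Y ∧ remove Y g = X ∧ Y g = 1) ↔ (P.reorient {g}).Acyclic := by
  classical
  have hflip : ∀ (X : α → SignType), SignedSet.flip {g} X g = - X g := fun X => by
    simp [SignedSet.flip]
  have hflip' : ∀ (X : α → SignType) {x}, x ≠ g → SignedSet.flip {g} X x = X x := fun X x hx => by
    simp [SignedSet.flip, hx]
  constructor
  · intro h
    have through : ∀ Z, (P.reorient {g}).IsCircuit Z → Positive Z → Z g ≠ 0 → False := by
      intro Z hZ hpos hZg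
      have hZg1 : Z g = 1 := by
        have := hpos g
        generalize Z g = s at *
        decide +revert
      have hY : P.IsCircuit (SignedSet.flip {g} Z) := hZ
      have hs := P.support_circuit _ hY
      have hgs : g ∈ support (SignedSet.flip {g} Z) := by simpa [support_flip] using hZg
      -- As `g` is not a loop, the circuit has an element besides `g`. There the prescribed lift `Y`
      -- agrees with the flip of `Z`, while on `g` the two are opposite, so neither `Y = flip Z` nor
      -- `Y = -flip Z` is possible.
      have hnt : (support (SignedSet.flip {g} Z)).Nontrivial := by
        refine (Set.nontrivial_iff_ne_singleton hgs).2 fun h1 => ?_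
        rw [h1, Matroid.singleton_isCircuit] at hs
        exact hg.not_isLoop hs
      have hc := hs.contractElem_isCircuit hnt hgs
      rw [← support_remove] at hc
      obtain ⟨Y, hY', hYr, hYg⟩ := h (remove (SignedSet.flip {g} Z) g)
        ((P.isCircuit_contract_iff g _).2 ⟨hc, _, hY, rfl⟩) fun x => by
          by_cases hx : x = g
          · rw [hx, remove_apply_self]
          · rw [remove_apply_of_ne _ hx, hflip' _ hx]
            exact hpos x
      obtain ⟨x, hx⟩ := hc.nonempty
      have hxg : x ≠ g := fun h => by simp [h, remove_apply_self] at hx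
      have hYx : ∀ x, x ≠ g → Y x = SignedSet.flip {g} Z x := fun x hx => by
        rw [← remove_apply_of_ne Y hx, hYr, remove_apply_of_ne _ hx]
      have hsupp : support Y = support (SignedSet.flip {g} Z) := by
        ext y
        by_cases hy : y = g
        · subst hy
          simp [hYg, hflip, hZg]
        · rw [mem_support, mem_support, hYx y hy]
      rcases P.eq_or_neg_circuit _ _ hY' hY hsupp with h' | h'
      · have := congrFun h' g
        rw [hYg, hflip, hZg1] at this
        exact absurd this (by decide)
      · have h1 := congrFun h' x
        rw [Pi.neg_apply, hYx x hxg] at h1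
        rw [mem_support, remove_apply_of_ne _ hxg] at hx
        have hs : ∀ s : SignType, s ≠ 0 → s ≠ -s := by decide
        exact hs _ hx h1
    intro Z hZ hpos
    by_cases hZg : Z g = 0
    swap
    · exact through Z hZ hpos hZg
    have hZf : SignedSet.flip {g} Z = Z := by
      funext x
      by_cases hx : x = g
      · rw [hx, hflip, hZg]; rfl
      · rw [hflip' _ hx]
    have hfin : (support Z).Finite :=
      P.ground_finite.subset ((P.reorient {g}).support_circuit Z hZ).subset_ground
    have hZP : P.IsCircuit Z := hZf ▸ (hZ : P.IsCircuit (SignedSet.flip {g} Z))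
    -- The support of `Z` is black and the rest, apart from `g`, is red. A circuit is then positive
    -- through `g`. A cocircuit contains `g` and, by orthogonality, misses `Z`, so `Z` survives as a
    -- circuit of `P / g`.
    rcases (P.reorient {g}).painting hfin.toFinset (e := g) hg.mem_ground (by simpa using hZg) ∅
      (by simp) (by simp) with ⟨X, hX, hXg, hXB, hXs⟩ | ⟨D, hD, hDg, hDB, -⟩
    · refine through X hX (fun x => ?_) (by simp [hXg])
      by_cases hx : X x = 0
      · exact hx.ge
      · rcases hXs x hx with rfl | h | h
        · rw [hXg]; decide
        · exact hXB x h
        · exact h.elim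
    · have hmul : ∀ s t : SignType, 0 ≤ s → 0 ≤ t → 0 ≤ s * t := by decide
      have hZD := Orthogonal.mul_eq_zero ((P.reorient {g}).orthogonal Z D hZ hD) fun x => by
        by_cases hx : Z x = 0
        · simp [hx]
        · exact hmul _ _ (hpos x) (hDB x (by simpa using hx))
      have hc : (P.toMatroid ／ {g}).IsCircuit (support Z) :=
        (P.support_circuit Z hZP).isCircuit_contractElem_of_disjoint_isCocircuit
          ((P.reorient {g}).support_cocircuit D hD) (by simp [hDg])
          (Set.disjoint_left.2 fun x hx hx' => mul_ne_zero hx hx' (hZD x))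
      have hZr : remove Z g = Z := by
        funext x
        by_cases hx : x = g
        · rw [hx, remove_apply_self, hZg]
        · rw [remove_apply_of_ne _ hx]
      obtain ⟨Y, hY, hYr, hYg⟩ := h Z ((P.isCircuit_contract_iff g Z).2 ⟨hc, Z, hZP, hZr⟩) hpos
      have hsub : support Z ⊆ support Y := by
        rw [← hYr, support_remove]
        exact Set.sdiff_subset
      have heq := (P.support_circuit Z hZP).eq_of_subset_isCircuit (P.support_circuit Y hY) hsub
      have : g ∈ support Z := heq ▸ (by simp [hYg] : g ∈ support Y)
      exact this hZg
  · intro h X hX hpos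
    obtain ⟨-, Y, hY, rfl⟩ := (P.isCircuit_contract_iff g X).1 hX
    refine ⟨Y, hY, rfl, ?_⟩
    by_contra hYg
    refine h (SignedSet.flip {g} Y) ?_ fun x => ?_
    · change P.IsCircuit (SignedSet.flip {g} (SignedSet.flip {g} Y))
      rwa [SignedSet.flip_flip]
    · by_cases hx : x = g
      · rw [hx, hflip]
        generalize Y g = s at *
        decide +revert
      · rw [hflip' _ hx, ← remove_apply_of_ne Y hx]
        exact hpos x

theorem reorient_reorient (P : OrientedMatroid α) (A B : Set α) :
    (P.reorient A).reorient B = P.reorient (symmDiff A B) := by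
  refine ext_of_dual rfl (fun X => ?_) fun X => ?_
  · change P.IsCircuit (SignedSet.flip A (SignedSet.flip B X)) ↔ P.IsCircuit _
    rw [flip_flip_eq_symmDiff]
  · change P.IsCocircuit (SignedSet.flip A (SignedSet.flip B X)) ↔ P.IsCocircuit _
    rw [flip_flip_eq_symmDiff]

theorem reorient_reorient_of_disjoint (P : OrientedMatroid α) {A B : Set α} (h : Disjoint A B) :
    (P.reorient A).reorient B = P.reorient (A ∪ B) := by
  rw [reorient_reorient, h.symmDiff_eq_sup]
  rfl

/-- The two flips of `X` are opposite: each element of the support is reversed by exactly one of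
them. -/
theorem isCircuit_flip_of_compl {P : OrientedMatroid α} {A B : Set α}
    (h : ∀ x ∈ P.toMatroid.E, x ∈ A ↔ x ∉ B) {X : α → SignType}
    (hX : P.IsCircuit (SignedSet.flip A X)) :
    P.IsCircuit (SignedSet.flip B X) := by
  have hs := (P.support_circuit _ hX).subset_ground
  rw [support_flip] at hs
  have : SignedSet.flip B X = - SignedSet.flip A X := by
    funext x
    by_cases hx : X x = 0
    · simp [SignedSet.flip, hx]
    · have := h x (hs hx)
      by_cases hB : x ∈ B <;> simp [SignedSet.flip, this, hB]
  rw [this]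
  exact P.neg_circuit _ hX

/-- Opposite reorientations coincide. -/
theorem reorient_eq_of_compl (P : OrientedMatroid α) {A B : Set α}
    (h : ∀ x ∈ P.toMatroid.E, x ∈ A ↔ x ∉ B) : P.reorient A = P.reorient B := by
  have h' : ∀ x ∈ P.toMatroid.E, x ∈ B ↔ x ∉ A := fun x hx => by rw [h x hx, not_not]
  exact ext_of_dual rfl (fun X => ⟨isCircuit_flip_of_compl h, isCircuit_flip_of_compl h'⟩)
    fun X => ⟨isCircuit_flip_of_compl (P := P.dual) h, isCircuit_flip_of_compl (P := P.dual) h'⟩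

/-! ### Compatibility as acyclicity and total cyclicity -/

/-- Compatibility with a lifting, in terms of the reorientation of the lifting at the new
element. -/
theorem compatibleWithLifting_iff (N : OrientedMatroid α) {f g : α} (hfg : f ≠ g)
    (hg : N.toMatroid.IsNonloop g) {A : Set α} (hfA : f ∉ A) (hgA : g ∉ A) :
    ((N.contract g).delete f).CompatibleWithLifting (N.delete f) g A ↔
      ((N.reorient (A ∪ {f, g})).delete f).Acyclic := by
  have hg' : ((N.delete f).reorient A).toMatroid.IsNonloop g :=
    Matroid.delete_isNonloop_iff.2 ⟨hg, by simpa using hfg.symm⟩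
  rw [contract_delete_comm N hfg]
  unfold CompatibleWithLifting
  simp_rw [← isCircuit_contract_reorient_iff]
  rw [forall_lift_iff_acyclic _ hg', reorient_reorient_of_disjoint _ (by simpa using hgA)]
  refine forall_congr' fun X => imp_congr_left ?_
  change N.IsCircuit (SignedSet.flip _ X) ∧ SignedSet.flip _ X f = 0 ↔
    N.IsCircuit (SignedSet.flip _ X) ∧ X f = 0
  have h0 : SignedSet.flip (A ∪ {g}) X f = 0 ↔ X f = 0 := by
    simpa using not_congr (Set.ext_iff.1 (support_flip (A ∪ {g}) X) f)
  rw [h0]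
  -- A circuit avoiding `f` does not see whether `f` is reversed.
  refine and_congr_left fun hX => ?_
  have : SignedSet.flip (A ∪ {g}) X = SignedSet.flip (A ∪ {f, g}) X := by
    funext x
    by_cases hx : x = f
    · subst hx
      simp [SignedSet.flip, hX]
    · have hx' : x ∈ A ∪ {g} ↔ x ∈ A ∪ {f, g} := by simp [hx]
      by_cases hxA : x ∈ A ∪ {g}
      · simp only [SignedSet.flip, if_pos hxA, if_pos (hx'.1 hxA)]
      · simp only [SignedSet.flip, if_neg hxA, if_neg (mt hx'.2 hxA)]
  rw [this]

/-- Compatibility with an extension, in terms of the reorientation of the extension at the new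
element. -/
theorem compatibleWithExtension_iff (N : OrientedMatroid α) {f g : α} (hfg : f ≠ g)
    (hf : N.toMatroid✶.IsNonloop f) {A : Set α} (hfA : f ∉ A) (hgA : g ∉ A) :
    ((N.contract g).delete f).CompatibleWithExtension (N.contract g) f A ↔
      ((N.reorient (A ∪ {f, g})).contract g).TotallyCyclic := by
  rw [totallyCyclic_iff_acyclic_dual, dual_contract]
  -- Duality exchanges deletion with contraction, hence `f` with `g`.
  have h := compatibleWithLifting_iff N.dual hfg.symm hf hgA hfA
  rw [contract_delete_comm N.dual hfg.symm, ← dual_contract, ← dual_delete,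
    Set.pair_comm g f] at h
  exact h

variable {M N : OrientedMatroid α} {f g : α}

theorem compatible_iff_of_isGenericExtensionLifting (hN : N.IsGenericExtensionLifting M f g)
    {A : Set α} (hA : A ⊆ M.toMatroid.E) :
    M.Compatible N f g A ↔ N.IsBoundedReorientation f g (A ∪ {f, g}) := by
  obtain ⟨hf, hg, hfg, hE, rfl, hext, hlift⟩ := hN
  have hfA : f ∉ A := fun h => hf (hA h)
  have hgA : g ∉ A := fun h => hg (hA h)
  have hsub : A ∪ {f, g} ⊆ N.toMatroid.E := hE ▸ Set.union_subset_union_left _ hA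
  -- Genericity of the lifting puts `g` in a cocircuit; dually, below, `f` lies in a circuit.
  have hg0 : N.toMatroid.IsNonloop g := by
    obtain ⟨B, hB⟩ := (N.contract g).toMatroid.exists_isBase
    obtain ⟨hD, hgD⟩ := (hlift.2 _).2 ⟨B, hB, rfl⟩
    exact hD.isNonloop_of_mem hgD
  have hf0 : N.toMatroid✶.IsNonloop f := by
    obtain ⟨B, hB⟩ := (N.delete f).toMatroid.exists_isBase
    obtain ⟨hC, hfC⟩ := (hext.2 _).2 ⟨B, hB, rfl⟩
    exact hC.isCocircuit.isNonloop_of_mem hfC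
  rw [Compatible, IsBoundedReorientation, compatibleWithLifting_iff N hfg hg0 hfA hgA,
    compatibleWithExtension_iff N hfg hf0 hfA hgA, and_comm (a := Acyclic _)]
  exact and_congr_left fun _ => iff_of_true hA hsub

theorem reorient_union_pair_eq_reorient_diff (hN : N.IsGenericExtensionLifting M f g) (A : Set α) :
    N.reorient (A ∪ {f, g}) = N.reorient (M.toMatroid.E \ A) := by
  obtain ⟨hf, hg, -, hE, -⟩ := hN
  refine reorient_eq_of_compl N fun x hx => ?_
  rw [hE] at hx
  simp only [Set.mem_union, Set.mem_insert_iff, Set.mem_singleton_iff, Set.mem_sdiff] at hx ⊢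
  constructor
  · rintro (h | rfl | rfl)
    exacts [fun h' => h'.2 h, fun h' => hf h'.1, fun h' => hg h'.1]
  · intro h
    by_cases hxA : x ∈ A
    · exact Or.inl hxA
    · exact hx.imp_left fun h' => absurd ⟨h', hxA⟩ h

theorem isBoundedReorientation_union_pair_iff (hN : N.IsGenericExtensionLifting M f g)
    {A : Set α} (hA : A ⊆ M.toMatroid.E) :
    N.IsBoundedReorientation f g (A ∪ {f, g}) ↔
      N.IsBoundedReorientation f g (M.toMatroid.E \ A) := by
  have hE := hN.2.2.2.1
  rw [IsBoundedReorientation, IsBoundedReorientation, reorient_union_pair_eq_reorient_diff hN A, hE]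
  exact and_congr_left fun _ => iff_of_true (Set.union_subset_union_left _ hA)
    (Set.sdiff_subset.trans Set.subset_union_left)

end OrientedMatroid

/-! ### The two bijections -/

theorem proposition2 {α : Type*} (M N : OrientedMatroid α) (f g : α)
    (hN : N.IsGenericExtensionLifting M f g) :
    -- the mapping `-_A M ↦ -_{fg} -_A N`, as a mapping of reorientations labelled by sets,
    -- onto the bounded reorientations of `N` in which both `f` and `g` are reoriented
    (∀ A ⊆ M.toMatroid.E, (N.reorient A).reorient {f, g} = N.reorient (A ∪ {f, g})) ∧
    Set.BijOn (fun A : Set α => A ∪ {f, g})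
      {A | M.Compatible N f g A}
      {A' | f ∈ A' ∧ g ∈ A' ∧ N.IsBoundedReorientation f g A'} ∧
    -- the same mapping, the oriented matroid `-_{fg} -_A N` being labelled by the complementary
    -- set, onto the bounded regions of `N` (in which neither `f` nor `g` is reoriented)
    (∀ A ⊆ M.toMatroid.E, (N.reorient A).reorient {f, g} = N.reorient (M.toMatroid.E \ A)) ∧
    Set.BijOn (fun A : Set α => M.toMatroid.E \ A)
      {A | M.Compatible N f g A}
      {A' | N.IsBoundedRegion f g A'} := by
  have hf := hN.1
  have hg := hN.2.1
  have hE := hN.2.2.2.1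
  have hunion : ∀ A ⊆ M.toMatroid.E, (N.reorient A).reorient {f, g} = N.reorient (A ∪ {f, g}) := by
    intro A hA
    refine N.reorient_reorient_of_disjoint (Set.disjoint_right.2 ?_)
    rintro x (rfl | rfl) hx
    exacts [hf (hA hx), hg (hA hx)]
  refine ⟨hunion, ⟨?_, ?_, ?_⟩, fun A hA => ?_, ⟨?_, ?_, ?_⟩⟩
  · exact fun A hA => ⟨by simp, by simp,
      (OrientedMatroid.compatible_iff_of_isGenericExtensionLifting hN hA.1).1 hA⟩
  · have key : ∀ A ⊆ M.toMatroid.E, (A ∪ {f, g}) ∩ M.toMatroid.E = A := by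
      intro A hA
      have h : ({f, g} : Set α) ∩ M.toMatroid.E = ∅ := by
        rw [← Set.disjoint_iff_inter_eq_empty]
        simp [hf, hg]
      rw [Set.union_inter_distrib_right, h, Set.union_empty, Set.inter_eq_left.2 hA]
    intro A hA B hB h
    rw [← key A hA.1, ← key B hB.1]
    exact congrArg (· ∩ M.toMatroid.E) h
  · rintro A' ⟨hfA, hgA, hA'⟩
    have hunion' : A' \ {f, g} ∪ {f, g} = A' :=
      Set.sdiff_union_of_subset (Set.insert_subset hfA (Set.singleton_subset_iff.2 hgA))
    have hsub : A' \ {f, g} ⊆ M.toMatroid.E := fun x hx =>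
      (hE.subset (hA'.1 hx.1)).resolve_right hx.2
    exact ⟨A' \ {f, g},
      (OrientedMatroid.compatible_iff_of_isGenericExtensionLifting hN hsub).2 (hunion'.symm ▸ hA'),
      hunion'⟩
  · rw [hunion A hA, OrientedMatroid.reorient_union_pair_eq_reorient_diff hN A]
  · exact fun A hA => ⟨fun h => hf h.1, fun h => hg h.1,
      (OrientedMatroid.isBoundedReorientation_union_pair_iff hN hA.1).1
        ((OrientedMatroid.compatible_iff_of_isGenericExtensionLifting hN hA.1).1 hA)⟩
  · intro A hA B hB h
    rw [← Set.sdiff_sdiff_cancel_left hA.1, ← Set.sdiff_sdiff_cancel_left hB.1]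
    exact congrArg (M.toMatroid.E \ ·) h
  · rintro A' ⟨hfA, hgA, hA'⟩
    have hsub : A' ⊆ M.toMatroid.E := fun x hx =>
      (hE.subset (hA'.1 hx)).resolve_right fun h => by
        rcases h with rfl | rfl
        exacts [hfA hx, hgA hx]
    have hdiff := Set.sdiff_sdiff_cancel_left hsub
    have hE' : M.toMatroid.E \ A' ⊆ M.toMatroid.E := Set.sdiff_subset
    exact ⟨M.toMatroid.E \ A',
      (OrientedMatroid.compatible_iff_of_isGenericExtensionLifting hN hE').2
        ((OrientedMatroid.isBoundedReorientation_union_pair_iff hN hE').2 (hdiff.symm ▸ hA')),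
      hdiff⟩
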